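/- Let $n\ge 1$ be an integer and let $\alpha\in(0,2]$, $\nu>0$. Let $q_{\alpha,\nu,n}:(0,\infty)\to\mathbb{R}$ denote the radial profile of the $n$-variate generalized Linnik density, i.e. the (unique) continuous function on $(0,\infty)$ such that $\mathbf{x}\mapsto q_{\alpha,\nu,n}(\Vert\mathbf{x}\Vert)$ is Lebesgue integrable on $\mathbb{R}^n$ and $$\int_{\mathbb{R}^n}e^{i\,\mathbf{x}\cdot\boldsymbol{t}}\,q_{\alpha,\nu,n}(\Vert\mathbf{x}\Vert)\,d^n\mathbf{x}=\frac{1}{\left(1+\Vert\boldsymbol{t}\Vert^{\alpha}\right)^{\nu}}\qquad\text{for all }\boldsymbol{t}\in\mathbb{R}^n,$$ where $\Vert\cdot\Vert$ is the Euclidean norm. Suppose that either (i) $\alpha\in(0,2)$ and $\alpha\nu\in(0,2]$, or (ii) $\alpha=2$ and $\nu\in\left(0,\frac{n+1}{2}\right]$. Then $q_{\alpha,\nu,n}$ exists and is completely monotonic on $(0,\infty)$: it is infinitely differentiable there and $(-1)^k q_{\alpha,\nu,n}^{(k)}(r)\ge 0$ for all $k=0,1,2,\ldots$ and all $r>0$.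 -/

import Mathlib

open MeasureTheory Set
open scoped ContDiff

/-- The `n`-variate generalized Linnik characteristic function
`t ↦ (1 + ‖t‖ ^ α)⁻ᵛ` on Euclidean space `ℝⁿ`. -/
noncomputable def linnikCharFun (α ν : ℝ) (n : ℕ) (t : EuclideanSpace ℝ (Fin n)) : ℝ :=
  1 / (1 + ‖t‖ ^ α) ^ ν

/-- `p` is a version of the Linnik density: a Lebesgue integrable function on `ℝⁿ` with
`∫ exp (i x·t) p x dx = (1 + ‖t‖ ^ α)⁻ᵛ` for every `t`. Such a function is determined up to a
null set. The case `t = 0` says that its integral is `1`. -/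
structure IsLinnikDensity (α ν : ℝ) (n : ℕ) (p : EuclideanSpace ℝ (Fin n) → ℝ) : Prop where
  integrable : Integrable p volume
  fourier : ∀ t : EuclideanSpace ℝ (Fin n),
    ∫ x, Complex.exp (Complex.I * ((inner ℝ x t : ℝ) : ℂ)) * ((p x : ℝ) : ℂ) =
      ((linnikCharFun α ν n t : ℝ) : ℂ)

/-- `q` is the radial profile `q_{α,ν,n}` of the Linnik density: `x ↦ q ‖x‖` is a version of the
density. Continuity on `(0, ∞)` selects the version, so that the values of `q` on `(0, ∞)` are
determined (for `n ≥ 1`); its values elsewhere are irrelevant. -/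
structure IsLinnikRadialDensity (α ν : ℝ) (n : ℕ) (q : ℝ → ℝ) : Prop where
  continuousOn : ContinuousOn q (Ioi 0)
  density : IsLinnikDensity α ν n (fun x => q ‖x‖)

/-- `f` is completely monotonic on `(0, ∞)`: it is infinitely differentiable there and
`(-1) ^ k * f⁽ᵏ⁾ r ≥ 0` for all `k = 0, 1, 2, …` and all `r > 0`. -/
def CompletelyMonotonic (f : ℝ → ℝ) : Prop :=
  ContDiffOn ℝ ∞ f (Ioi 0) ∧ ∀ k : ℕ, ∀ r : ℝ, 0 < r → 0 ≤ (-1 : ℝ) ^ k * iteratedDeriv k f r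

/-! The profile is exhibited as the Laplace transform of a positive measure, a mixture of `exp (-r *
Y)` with `Y > 0`; every such transform is completely monotonic, and uniqueness of Fourier transforms
carries this to any continuous version. On `ℝⁿ` the function `exp (-y ‖x‖)` has Fourier transform `C
* y * (y² + ‖t‖²) ^ (-(n+1)/2)` (`fourier_exp_neg_norm`). It therefore suffices
(`linnik_of_mixture`) to write the characteristic function, in the variable `s = ‖t‖²`, as a
positive mixture of powers `(λ + s) ^ (-(n+1)/2)`, i.e. as a generalized Stieltjes function of order
`(n+1)/2`. Any smaller positive order is enough (`linnik_of_stieltjes`). For `α = 2`, `(1 + s) ^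
(-ν)` has order `ν`, with a point mass at `λ = 1`. For `α < 2`, put `β = α / 2`: Cauchy's theorem on
the plane cut along the negative axis shows that `(1 + s ^ β) ^ (-ν)` has order one, its weight
being the imaginary part on the cut. That weight is nonnegative because `β * ν ≤ 1`
(`linnikLog_im_nonneg`). -/

/-! ### Uniqueness of the density and of its radial profile. -/

theorem ae_eq_zero_of_forall_fourier_eq_zero {E : Type*} [NormedAddCommGroup E]
    [InnerProductSpace ℝ E] [CompleteSpace E] [SecondCountableTopology E] [MeasurableSpace E]
    [BorelSpace E] {μ : Measure E} [SigmaFinite μ] {h : E → ℝ} (hh : Integrable h μ)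
    (h0 : ∀ t : E, ∫ x, Complex.exp (Complex.I * ((inner ℝ x t : ℝ) : ℂ)) * (h x : ℂ) ∂μ = 0) :
    h =ᵐ[μ] 0 := by
  have hpos : ∀ g : E → ℝ, Integrable g μ → ∀ t : E,
      charFun (μ.withDensity fun x => ENNReal.ofReal (g x)) t =
        ∫ x, Complex.exp (Complex.I * ((inner ℝ x t : ℝ) : ℂ)) * ((max (g x) 0 : ℝ) : ℂ) ∂μ := by
    intro g hg t
    rw [charFun_apply, integral_withDensity_eq_integral_toReal_smul₀
      hg.aestronglyMeasurable.aemeasurable.ennreal_ofReal (by simp)]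
    refine integral_congr_ae (ae_of_all _ fun x => ?_)
    simp only [ENNReal.toReal_ofReal', Complex.real_smul]
    rw [mul_comm, mul_comm Complex.I]
  have hexp : ∀ g : E → ℝ, Integrable g μ → ∀ t : E, Integrable (fun x =>
      Complex.exp (Complex.I * ((inner ℝ x t : ℝ) : ℂ)) * (g x : ℂ)) μ := by
    intro g hg t
    refine hg.ofReal.bdd_mul (c := 1) (by fun_prop) (ae_of_all _ fun x => ?_)
    rw [mul_comm, Complex.norm_exp_ofReal_mul_I]
  have hfin : ∀ g : E → ℝ, Integrable g μ →
      IsFiniteMeasure (μ.withDensity fun x => ENNReal.ofReal (g x)) := fun g hg =>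
    isFiniteMeasure_withDensity_ofReal hg.2
  have := hfin h hh
  have := hfin (fun x => -h x) hh.neg
  have hneg : Integrable (fun x => -h x) μ := hh.neg
  -- The positive and negative parts of `h` define finite measures with the same characteristic
  -- function, hence equal measures.
  have key : μ.withDensity (fun x => ENNReal.ofReal (h x)) =
      μ.withDensity fun x => ENNReal.ofReal (-h x) := by
    refine Measure.ext_of_charFun (funext fun t => ?_)
    rw [hpos h hh, hpos _ hneg, ← sub_eq_zero, ← integral_sub (hexp _ hh.pos_part t)
      (hexp _ hneg.pos_part t), ← h0 t]
    refine integral_congr_ae (ae_of_all _ fun x => ?_)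
    simp only [← mul_sub, ← Complex.ofReal_sub]
    congr 2
    rcases le_total 0 (h x) with hx | hx
    · rw [max_eq_left hx, max_eq_right (by simpa using hx), sub_zero]
    · rw [max_eq_right hx, max_eq_left (by simpa using hx)]; simp
  have hae := (withDensity_eq_iff_of_sigmaFinite
    hh.aestronglyMeasurable.aemeasurable.ennreal_ofReal
    hh.neg.aestronglyMeasurable.aemeasurable.ennreal_ofReal).1 key
  filter_upwards [hae] with x hx
  have hx' := congrArg ENNReal.toReal hx
  simp only [ENNReal.toReal_ofReal', Pi.neg_apply] at hx'
  rcases le_total 0 (h x) with h1 | h1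
  · rw [max_eq_left h1, max_eq_right (by simpa using h1)] at hx'; simpa using hx'
  · rw [max_eq_right h1, max_eq_left (by simpa using h1)] at hx'
    simp only [Pi.zero_apply]; linarith

theorem IsLinnikRadialDensity.eqOn {α ν : ℝ} {n : ℕ} (hn : 1 ≤ n) {p q : ℝ → ℝ}
    (hp : IsLinnikRadialDensity α ν n p) (hq : IsLinnikRadialDensity α ν n q) :
    EqOn p q (Ioi 0) := by
  have : Nonempty (Fin n) := ⟨⟨0, hn⟩⟩
  have hexp : ∀ g : EuclideanSpace ℝ (Fin n) → ℝ, Integrable g → ∀ t, Integrable (fun x =>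
      Complex.exp (Complex.I * ((inner ℝ x t : ℝ) : ℂ)) * (g x : ℂ)) := by
    intro g hg t
    refine hg.ofReal.bdd_mul (c := 1) (by fun_prop) (ae_of_all _ fun x => ?_)
    rw [mul_comm, Complex.norm_exp_ofReal_mul_I]
  have hae := ae_eq_zero_of_forall_fourier_eq_zero (hp.density.integrable.sub hq.density.integrable)
    (fun t => by
      have h1 := integral_sub (hexp _ hp.density.integrable t) (hexp _ hq.density.integrable t)
      rw [hp.density.fourier, hq.density.fourier, sub_self] at h1
      rw [← h1]
      refine integral_congr_ae (ae_of_all _ fun x => ?_)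
      simp [mul_sub])
  have hU : IsOpen {x : EuclideanSpace ℝ (Fin n) | 0 < ‖x‖} :=
    isOpen_lt continuous_const continuous_norm
  have hE : EqOn (fun x : EuclideanSpace ℝ (Fin n) => p ‖x‖) (fun x => q ‖x‖) {x | 0 < ‖x‖} := by
    refine Measure.eqOn_open_of_ae_eq (μ := volume) ?_ hU
      (hp.continuousOn.comp continuous_norm.continuousOn fun x hx => hx)
      (hq.continuousOn.comp continuous_norm.continuousOn fun x hx => hx)
    refine ae_restrict_of_ae ?_
    filter_upwards [hae] with x hx
    exact sub_eq_zero.1 hx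
  intro r hr
  obtain ⟨x, hx⟩ := exists_norm_eq (EuclideanSpace ℝ (Fin n)) (le_of_lt hr)
  have := hE (show 0 < ‖x‖ by rw [hx]; exact hr)
  simpa [hx] using this

/-! ### Complete monotonicity of Laplace transforms. -/

theorem CompletelyMonotonic.congr {f g : ℝ → ℝ} (hf : CompletelyMonotonic f)
    (h : EqOn g f (Ioi 0)) : CompletelyMonotonic g := by
  refine ⟨hf.1.congr h, fun k r hr => ?_⟩
  rw [((h.eventuallyEq_of_mem (Ioi_mem_nhds hr)).iteratedDeriv k).eq_of_nhds]
  exact hf.2 k r hr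

/-- Differentiating under the integral gives `∫ (-Y) ^ k * exp (-r Y)`, whose sign is `(-1) ^ k`. -/
theorem completelyMonotonic_mgf_neg {Ω : Type*} [MeasurableSpace Ω] {m : Measure Ω} {Y : Ω → ℝ}
    (hY : ∀ x, 0 ≤ Y x)
    (hint : ∀ r : ℝ, 0 < r → Integrable (fun x => Real.exp (r * -Y x)) m) :
    CompletelyMonotonic (ProbabilityTheory.mgf (fun x => -Y x) m) := by
  have hsub : Ioi (0 : ℝ) ⊆ interior (ProbabilityTheory.integrableExpSet (fun x => -Y x) m) :=
    interior_maximal (fun r hr => hint r hr) isOpen_Ioi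
  refine ⟨(ProbabilityTheory.analyticOnNhd_mgf.mono hsub).contDiffOn (uniqueDiffOn_Ioi 0),
    fun k r hr => ?_⟩
  rw [ProbabilityTheory.iteratedDeriv_mgf (hsub hr), ← integral_const_mul]
  refine integral_nonneg fun x => ?_
  rw [Pi.zero_apply, ← mul_assoc, ← mul_pow]
  have := hY x
  have h2 : (0 : ℝ) ≤ -1 * -Y x := by linarith
  positivity

/-! ### The Fourier transform of `exp (-y ‖x‖)` by Gaussian subordination. -/

open Filter Topology in
/-- The one-dimensional subordination identity, evaluated with the antiderivative expressed through
`G v = ∫ u in 0..v, exp (-u ^ 2)`. -/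
theorem integral_exp_neg_sq_add_div_sq {y c : ℝ} (hy : 0 < y) (hc : 0 < c) :
    IntegrableOn (fun x : ℝ => Real.exp (-(x ^ 2 * y ^ 2) - c ^ 2 / x ^ 2)) (Ioi 0) ∧
    ∫ x in Ioi (0 : ℝ), Real.exp (-(x ^ 2 * y ^ 2) - c ^ 2 / x ^ 2) =
      √Real.pi / (2 * y) * Real.exp (-(2 * c * y)) := by
  set G : ℝ → ℝ := fun v => ∫ u in (0 : ℝ)..v, Real.exp (-u ^ 2) with hG
  have hGd : ∀ v, HasDerivAt G (Real.exp (-v ^ 2)) v := fun v =>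
    (by fun_prop : Continuous fun u : ℝ => Real.exp (-u ^ 2)).integral_hasStrictDerivAt 0 v
      |>.hasDerivAt
  have hint : Integrable fun u : ℝ => Real.exp (-u ^ 2) := by
    simpa using integrable_exp_neg_mul_sq (b := 1) one_pos
  have hval : ∫ u in Ioi (0 : ℝ), Real.exp (-u ^ 2) = √Real.pi / 2 := by
    simpa using integral_gaussian_Ioi 1
  have hGtop : Tendsto G atTop (𝓝 (√Real.pi / 2)) := by
    rw [← hval]
    exact intervalIntegral_tendsto_integral_Ioi 0 hint.integrableOn tendsto_id
  have hGodd : ∀ v, G (-v) = -G v := by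
    intro v
    have := intervalIntegral.integral_comp_neg (a := 0) (b := v) fun u : ℝ => Real.exp (-u ^ 2)
    simp only [neg_sq, neg_zero] at this
    simp only [hG]
    rw [this, intervalIntegral.integral_symm]
  have hGbot : Tendsto G atBot (𝓝 (-(√Real.pi / 2))) := by
    refine ((hGtop.comp tendsto_neg_atBot_atTop).neg).congr fun v => ?_
    simp [hGodd]
  -- Since `(x y ± c / x)² = x² y² + c² / x² ± 2 c y`, the two terms have derivatives `f x * (y ∓ c
  -- / x²) / (2 y)`, and the `c / x²` parts cancel.
  set P : ℝ → ℝ := fun x => Real.exp (2 * c * y) / (2 * y) * G (x * y + c / x) +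
    Real.exp (-(2 * c * y)) / (2 * y) * G (x * y - c / x) with hP
  have hxy : Tendsto (fun x : ℝ => x * y) atTop atTop := tendsto_id.atTop_mul_const hy
  have hcx : Tendsto (fun x : ℝ => c / x) atTop (𝓝 0) := tendsto_const_nhds.div_atTop tendsto_id
  have hxy0 : Tendsto (fun x : ℝ => x * y) (𝓝[>] 0) (𝓝 0) := by
    have : Continuous fun x : ℝ => x * y := by fun_prop
    simpa using (this.tendsto 0).mono_left nhdsWithin_le_nhds
  have hcx0 : Tendsto (fun x : ℝ => c / x) (𝓝[>] 0) atTop := by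
    simpa [div_eq_mul_inv] using tendsto_inv_nhdsGT_zero.const_mul_atTop hc
  have htop : Tendsto P atTop (𝓝 (Real.exp (2 * c * y) / (2 * y) * (√Real.pi / 2) +
      Real.exp (-(2 * c * y)) / (2 * y) * (√Real.pi / 2))) := by
    refine ((hGtop.comp (hxy.atTop_add hcx)).const_mul _).add
      ((hGtop.comp ?_).const_mul _)
    simpa [sub_eq_add_neg] using hxy.atTop_add hcx.neg
  have hzero : Tendsto P (𝓝[>] 0) (𝓝 (Real.exp (2 * c * y) / (2 * y) * (√Real.pi / 2) +
      Real.exp (-(2 * c * y)) / (2 * y) * (-(√Real.pi / 2)))) := by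
    refine ((hGtop.comp (hxy0.add_atTop hcx0)).const_mul _).add
      ((hGbot.comp ?_).const_mul _)
    simpa [sub_eq_add_neg] using hxy0.add_atBot (tendsto_neg_atTop_atBot.comp hcx0)
  set f : ℝ → ℝ := fun x => Real.exp (-(x ^ 2 * y ^ 2) - c ^ 2 / x ^ 2) with hf
  have hderiv : ∀ x ∈ Ioi (0 : ℝ), HasDerivAt P (f x) x := by
    intro x hx
    have hx0 : x ≠ 0 := ne_of_gt hx
    have hd : HasDerivAt (fun x : ℝ => c / x) (-(c / x ^ 2)) x := by
      simpa [div_eq_mul_inv] using (hasDerivAt_inv hx0).const_mul c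
    have hm : HasDerivAt (fun x : ℝ => x * y) y x := hasDerivAt_mul_const y
    have h1 := ((hGd _).comp x (hm.add hd)).const_mul (Real.exp (2 * c * y) / (2 * y))
    have h2 := ((hGd _).comp x (hm.sub hd)).const_mul (Real.exp (-(2 * c * y)) / (2 * y))
    convert! h1.add h2 using 1
    have e1 : Real.exp (-(x * y + c / x) ^ 2) = f x * Real.exp (-(2 * c * y)) := by
      rw [hf, ← Real.exp_add]; congr 1; field_simp; ring
    have e2 : Real.exp (-(x * y - c / x) ^ 2) = f x * Real.exp (2 * c * y) := by
      rw [hf, ← Real.exp_add]; congr 1; field_simp; ring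
    have e3 : Real.exp (2 * c * y) * Real.exp (-(2 * c * y)) = 1 := by
      rw [← Real.exp_add]; simp
    simp only [Pi.add_apply, Pi.sub_apply]
    rw [e1, e2]
    have : f x = f x * (Real.exp (2 * c * y) * Real.exp (-(2 * c * y))) := by rw [e3, mul_one]
    field_simp
    field_simp at this
    linear_combination (2 * y * x ^ 2) * this
  -- With `c / 0 = 0`, `P 0` is `0` and not the limit of `P` at `0⁺`; the update restores right
  -- continuity.
  set P' : ℝ → ℝ := Function.update P 0 (Real.exp (2 * c * y) / (2 * y) * (√Real.pi / 2) +
      Real.exp (-(2 * c * y)) / (2 * y) * (-(√Real.pi / 2))) with hP'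
  have hcont : ContinuousWithinAt P' (Ici 0) 0 := by
    rw [hP', continuousWithinAt_update_same, Ici_sdiff_left]
    exact hzero
  have hderiv' : ∀ x ∈ Ioi (0 : ℝ), HasDerivAt P' (f x) x := by
    intro x hx
    refine (hderiv x hx).congr_of_eventuallyEq ?_
    filter_upwards [Ioi_mem_nhds hx] with z hz
    exact Function.update_of_ne (ne_of_gt hz) _ _
  have htop' : Tendsto P' atTop (𝓝 (Real.exp (2 * c * y) / (2 * y) * (√Real.pi / 2) +
      Real.exp (-(2 * c * y)) / (2 * y) * (√Real.pi / 2))) := by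
    refine htop.congr' ?_
    filter_upwards [Ioi_mem_atTop 0] with z hz
    exact (Function.update_of_ne (ne_of_gt hz) _ _).symm
  have hpos : ∀ x ∈ Ioi (0 : ℝ), 0 ≤ f x := fun x _ => (Real.exp_pos _).le
  refine ⟨integrableOn_Ioi_deriv_of_nonneg hcont hderiv' hpos htop', ?_⟩
  rw [integral_Ioi_of_hasDerivAt_of_nonneg hcont hderiv' hpos htop', hP',
    Function.update_self]
  ring

/-- The constant in the Fourier transform of `x ↦ exp (-y ‖x‖)` on `ℝⁿ`. -/
noncomputable def poissonConst (n : ℕ) : ℝ :=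
  (4 * Real.pi) ^ ((n : ℝ) / 2) / √Real.pi * Real.Gamma (((n : ℝ) + 1) / 2)

theorem poissonConst_pos (n : ℕ) : 0 < poissonConst n := by
  have := Real.Gamma_pos_of_pos (show (0 : ℝ) < ((n : ℝ) + 1) / 2 by positivity)
  have := Real.pi_pos
  unfold poissonConst
  positivity

/-- The integrand is the one of `integral_exp_neg_sq_add_div_sq` with `c = ‖x‖ / 2`, now read as a
Gaussian in `x`; the result is left in a form whose `u`-integral is a Gamma integral. -/
theorem fourier_gaussian_mul {n : ℕ} {u : ℝ} (hu : 0 < u) (y : ℝ)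
    (t : EuclideanSpace ℝ (Fin n)) :
    Integrable (fun x : EuclideanSpace ℝ (Fin n) => Complex.exp (Complex.I * ((inner ℝ x t : ℝ) : ℂ))
      * ((Real.exp (-(u ^ 2 * y ^ 2) - (‖x‖ / 2) ^ 2 / u ^ 2) : ℝ) : ℂ)) ∧
    ∫ x : EuclideanSpace ℝ (Fin n), Complex.exp (Complex.I * ((inner ℝ x t : ℝ) : ℂ))
      * ((Real.exp (-(u ^ 2 * y ^ 2) - (‖x‖ / 2) ^ 2 / u ^ 2) : ℝ) : ℂ) =
      (((4 * Real.pi) ^ ((n : ℝ) / 2) * (u ^ (n : ℝ) *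
        Real.exp (-(y ^ 2 + ‖t‖ ^ 2) * u ^ (2 : ℝ))) : ℝ) : ℂ) := by
  set b : ℝ := 1 / (4 * u ^ 2) with hb
  have hb0 : 0 < b := by positivity
  have hbre : 0 < (b : ℂ).re := by simpa using hb0
  have hfun : ∀ x : EuclideanSpace ℝ (Fin n), Complex.exp (Complex.I * ((inner ℝ x t : ℝ) : ℂ))
      * ((Real.exp (-(u ^ 2 * y ^ 2) - (‖x‖ / 2) ^ 2 / u ^ 2) : ℝ) : ℂ) =
      ((Real.exp (-(u ^ 2 * y ^ 2)) : ℝ) : ℂ) *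
        Complex.exp (-(b : ℂ) * ((‖x‖ : ℝ) : ℂ) ^ 2 + Complex.I * ((inner ℝ t x : ℝ) : ℂ)) := by
    intro x
    have hu' : (u : ℂ) ≠ 0 := by exact_mod_cast hu.ne'
    rw [real_inner_comm, Complex.ofReal_exp, Complex.ofReal_exp, ← Complex.exp_add,
      ← Complex.exp_add, hb]
    congr 1
    push_cast
    field_simp
    ring
  simp_rw [hfun]
  refine ⟨(GaussianFourier.integrable_cexp_neg_mul_sq_norm_add hbre Complex.I t).const_mul _, ?_⟩
  rw [integral_const_mul, GaussianFourier.integral_cexp_neg_mul_sq_norm_add hbre]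
  have h1 : ((Real.pi : ℂ) / (b : ℂ)) ^ ((Module.finrank ℝ (EuclideanSpace ℝ (Fin n)) : ℂ) / 2) =
      (((4 * Real.pi) ^ ((n : ℝ) / 2) * u ^ (n : ℝ) : ℝ) : ℂ) := by
    have : (4 * Real.pi) ^ ((n : ℝ) / 2) * u ^ (n : ℝ) = (Real.pi / b) ^ ((n : ℝ) / 2) := by
      have h2 : Real.pi / b = (4 * Real.pi) * u ^ (2 : ℝ) := by
        rw [hb, Real.rpow_two]; field_simp
      have h4 : (u ^ (2 : ℝ)) ^ ((n : ℝ) / 2) = u ^ (n : ℝ) := by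
        rw [← Real.rpow_mul hu.le, mul_div_cancel₀ _ two_ne_zero]
      rw [h2, Real.mul_rpow (x := 4 * Real.pi) (y := u ^ (2 : ℝ)) (by positivity)
        (by positivity), h4]
    rw [this, Complex.ofReal_cpow (by positivity), finrank_euclideanSpace_fin]
    push_cast
    rfl
  have h3 : Complex.exp (Complex.I ^ 2 * ((‖t‖ : ℝ) : ℂ) ^ 2 / (4 * (b : ℂ))) =
      ((Real.exp (-(‖t‖ ^ 2 * u ^ 2)) : ℝ) : ℂ) := by
    have hu' : (u : ℂ) ≠ 0 := by exact_mod_cast hu.ne'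
    rw [Complex.ofReal_exp, hb, Complex.I_sq]
    congr 1
    push_cast
    field_simp
  rw [h1, h3, ← Complex.ofReal_mul, ← Complex.ofReal_mul, Real.rpow_two]
  congr 1
  rw [show -(y ^ 2 + ‖t‖ ^ 2) * u ^ 2 = -(u ^ 2 * y ^ 2) + -(‖t‖ ^ 2 * u ^ 2) by ring, Real.exp_add]
  ring

/-- Subordination writes `exp (-‖x‖ y)` as an integral over `u` of Gaussians in `x`. Fubini then
leaves a Gamma integral in `u`, which produces the power `-(n+1)/2`. -/
theorem fourier_exp_neg_norm {n : ℕ} (hn : 1 ≤ n) {y : ℝ} (hy : 0 < y) :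
    Integrable (fun x : EuclideanSpace ℝ (Fin n) => Real.exp (-(‖x‖ * y))) ∧
    ∀ t : EuclideanSpace ℝ (Fin n),
      ∫ x : EuclideanSpace ℝ (Fin n), Complex.exp (Complex.I * ((inner ℝ x t : ℝ) : ℂ))
        * ((Real.exp (-(‖x‖ * y)) : ℝ) : ℂ) =
      ((poissonConst n * y * (y ^ 2 + ‖t‖ ^ 2) ^ (-(((n : ℝ) + 1) / 2)) : ℝ) : ℂ) := by
  have : Nonempty (Fin n) := ⟨⟨0, hn⟩⟩
  set κ : ℝ := ((n : ℝ) + 1) / 2 with hκ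
  set e : EuclideanSpace ℝ (Fin n) → EuclideanSpace ℝ (Fin n) → ℂ :=
    fun t x => Complex.exp (Complex.I * ((inner ℝ x t : ℝ) : ℂ)) with he
  set g : EuclideanSpace ℝ (Fin n) → ℝ → ℝ :=
    fun x u => Real.exp (-(u ^ 2 * y ^ 2) - (‖x‖ / 2) ^ 2 / u ^ 2) with hg
  have hn1 : (-1 : ℝ) < (n : ℝ) := by linarith [(n.cast_nonneg : (0 : ℝ) ≤ n)]
  have hGamma : ∀ a : ℝ, 0 < a → ∫ u in Ioi (0 : ℝ), u ^ (n : ℝ) * Real.exp (-a * u ^ (2 : ℝ)) =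
      a ^ (-κ) * (1 / 2) * Real.Gamma κ := by
    intro a ha
    rw [integral_rpow_mul_exp_neg_mul_rpow two_pos hn1 ha, hκ, neg_div]
  have hJ : ∀ t, Integrable (fun p : EuclideanSpace ℝ (Fin n) × ℝ => e t p.1 * (g p.1 p.2 : ℂ))
      ((volume : Measure (EuclideanSpace ℝ (Fin n))).prod (volume.restrict (Ioi (0 : ℝ)))) := by
    intro t
    have hmeas : AEStronglyMeasurable
        (fun p : EuclideanSpace ℝ (Fin n) × ℝ => e t p.1 * (g p.1 p.2 : ℂ))
        ((volume : Measure (EuclideanSpace ℝ (Fin n))).prod (volume.restrict (Ioi (0 : ℝ)))) := by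
      refine Measurable.aestronglyMeasurable ?_
      simp only [he, hg]
      fun_prop
    rw [integrable_prod_iff' hmeas]
    refine ⟨(ae_restrict_iff' measurableSet_Ioi).2 (ae_of_all _ fun u hu =>
      (fourier_gaussian_mul hu y t).1), ?_⟩
    have h0 := integrableOn_rpow_mul_exp_neg_mul_rpow hn1 two_pos (sq_pos_of_pos hy)
    refine (h0.const_mul ((4 * Real.pi) ^ ((n : ℝ) / 2))).congr ?_
    refine (ae_restrict_iff' measurableSet_Ioi).2 (ae_of_all _ fun u hu => ?_)
    -- The norm of the integrand does not depend on `t`, so its integral is the transform at `t =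
    -- 0`.
    have h1 := (fourier_gaussian_mul (n := n) hu y 0).2
    simp only [inner_zero_right, Complex.ofReal_zero, mul_zero, Complex.exp_zero, one_mul] at h1
    rw [integral_complex_ofReal, Complex.ofReal_inj] at h1
    simp only [norm_zero, ne_eq, OfNat.ofNat_ne_zero, not_false_eq_true, zero_pow, add_zero] at h1
    refine h1.symm.trans (integral_congr_ae (ae_of_all _ fun x => ?_))
    simp only [he, hg, norm_mul]
    rw [mul_comm Complex.I, Complex.norm_exp_ofReal_mul_I, one_mul, Complex.norm_real,
      Real.norm_of_nonneg (Real.exp_pos _).le]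
  have hsub : ∀ᵐ x : EuclideanSpace ℝ (Fin n), ∫ u in Ioi (0 : ℝ), g x u =
      √Real.pi / (2 * y) * Real.exp (-(‖x‖ * y)) := by
    filter_upwards [Measure.ae_ne volume (0 : EuclideanSpace ℝ (Fin n))] with x hx
    have hx' : 0 < ‖x‖ / 2 := by positivity
    rw [hg, (integral_exp_neg_sq_add_div_sq hy hx').2]
    congr 3
    ring
  have hpi : 0 < √Real.pi := Real.sqrt_pos.2 Real.pi_pos
  refine ⟨?_, fun t => ?_⟩
  · have h1 := (hJ 0).integral_prod_left.re
    refine (h1.const_mul (2 * y / √Real.pi)).congr ?_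
    filter_upwards [hsub] with x hx
    simp only [he, inner_zero_right, Complex.ofReal_zero, mul_zero, Complex.exp_zero, one_mul]
    rw [integral_complex_ofReal, hx]
    simp only [RCLike.re_eq_complex_re, Complex.ofReal_re]
    field_simp
  · have h1 := integral_integral_swap (f := fun x u => e t x * (g x u : ℂ)) (hJ t)
    have h2 : ∫ x, ∫ u in Ioi (0 : ℝ), e t x * (g x u : ℂ) =
        ((√Real.pi / (2 * y) : ℝ) : ℂ) * ∫ x, e t x * ((Real.exp (-(‖x‖ * y)) : ℝ) : ℂ) := by
      rw [← integral_const_mul]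
      refine integral_congr_ae ?_
      filter_upwards [hsub] with x hx
      rw [integral_const_mul, integral_complex_ofReal, hx]
      push_cast
      ring
    have h3 : ∫ u in Ioi (0 : ℝ), ∫ x, e t x * (g x u : ℂ) =
        (((4 * Real.pi) ^ ((n : ℝ) / 2) * ((y ^ 2 + ‖t‖ ^ 2) ^ (-κ) * (1 / 2) * Real.Gamma κ) : ℝ)
          : ℂ) := by
      rw [← hGamma _ (by positivity), ← integral_const_mul, ← integral_complex_ofReal]
      exact setIntegral_congr_fun measurableSet_Ioi fun u hu => (fourier_gaussian_mul hu y t).2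
    rw [h2, h3] at h1
    have h4 : ((√Real.pi / (2 * y) : ℝ) : ℂ) ≠ 0 := by
      rw [Complex.ofReal_ne_zero]; positivity
    refine mul_left_cancel₀ h4 (h1.trans ?_)
    rw [← Complex.ofReal_mul, poissonConst, ← hκ]
    congr 1
    field_simp

/-! ### From positive mixtures to completely monotonic densities. -/

/-- By Fubini the candidate profile `r ↦ ∫ exp (-r Y)` has the required transform. The hypothesis at
`a = 0` supplies the joint integrability. -/
theorem linnik_of_mixture {Ω : Type*} [MeasurableSpace Ω] {m : Measure Ω} [SFinite m] {Y : Ω → ℝ}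
    (hYm : Measurable Y) (hY : ∀ z, 0 < Y z) {α ν : ℝ} {n : ℕ} (hn : 1 ≤ n)
    (hmix : ∀ a : ℝ, 0 ≤ a → ∫⁻ z, ENNReal.ofReal
      (poissonConst n * Y z * (Y z ^ 2 + a ^ 2) ^ (-(((n : ℝ) + 1) / 2))) ∂m =
        ENNReal.ofReal (1 / (1 + a ^ α) ^ ν)) :
    (∃ q : ℝ → ℝ, IsLinnikRadialDensity α ν n q) ∧
      ∀ q : ℝ → ℝ, IsLinnikRadialDensity α ν n q → CompletelyMonotonic q := by
  have hC := poissonConst_pos n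
  have hnn : ∀ a z, 0 ≤ poissonConst n * Y z * (Y z ^ 2 + a ^ 2) ^ (-(((n : ℝ) + 1) / 2)) := by
    intro a z
    have := hY z
    positivity
  have hmeas : ∀ a : ℝ, Measurable fun z =>
      poissonConst n * Y z * (Y z ^ 2 + a ^ 2) ^ (-(((n : ℝ) + 1) / 2)) := fun a => by fun_prop
  have hval : ∀ a : ℝ, 0 ≤ a → ∫ z, poissonConst n * Y z *
      (Y z ^ 2 + a ^ 2) ^ (-(((n : ℝ) + 1) / 2)) ∂m = 1 / (1 + a ^ α) ^ ν := by
    intro a ha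
    rw [integral_eq_lintegral_of_nonneg_ae (ae_of_all _ (hnn a)) (hmeas a).aestronglyMeasurable,
      hmix a ha, ENNReal.toReal_ofReal (by positivity)]
  have hH : Integrable (fun p : EuclideanSpace ℝ (Fin n) × Ω => Real.exp (‖p.1‖ * -Y p.2))
      (volume.prod m) := by
    rw [integrable_prod_iff' (Measurable.aestronglyMeasurable (by fun_prop))]
    simp only [mul_neg]
    refine ⟨ae_of_all _ fun z => (fourier_exp_neg_norm hn (hY z)).1, ?_⟩
    have h1 : Integrable (fun z => poissonConst n * Y z *
        (Y z ^ 2 + 0 ^ 2) ^ (-(((n : ℝ) + 1) / 2))) m := by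
      refine ⟨(hmeas 0).aestronglyMeasurable, ?_⟩
      rw [hasFiniteIntegral_iff_ofReal (ae_of_all _ (hnn 0)), hmix 0 le_rfl]
      exact ENNReal.ofReal_lt_top
    refine h1.congr (ae_of_all _ fun z => ?_)
    have h2 := (fourier_exp_neg_norm hn (hY z)).2 0
    simp only [inner_zero_right, Complex.ofReal_zero, mul_zero, Complex.exp_zero, one_mul] at h2
    rw [integral_complex_ofReal, Complex.ofReal_inj, norm_zero] at h2
    refine h2.symm.trans (integral_congr_ae (ae_of_all _ fun x => ?_))
    exact (Real.norm_of_nonneg (Real.exp_pos _).le).symm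
  have hint : ∀ r : ℝ, 0 < r → Integrable (fun z => Real.exp (r * -Y z)) m := by
    intro r hr
    -- Fubini gives integrability only for almost every `x`; some such `x` has `‖x‖ < r`, and `exp
    -- (-‖x‖ Y)` dominates `exp (-r Y)`.
    have hdense := Measure.dense_of_ae hH.prod_right_ae
    obtain ⟨x, hx, hxr⟩ := hdense.exists_dist_lt 0 hr
    rw [dist_zero_left] at hxr
    refine Integrable.mono' hx (Measurable.aestronglyMeasurable (by fun_prop))
      (ae_of_all _ fun z => ?_)
    rw [Real.norm_of_nonneg (Real.exp_pos _).le]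
    exact Real.exp_le_exp.2 (by nlinarith [hY z])
  have hcm := completelyMonotonic_mgf_neg (fun z => (hY z).le) hint
  have hq : IsLinnikRadialDensity α ν n (ProbabilityTheory.mgf (fun z => -Y z) m) := by
    refine ⟨hcm.1.continuousOn, hH.integral_prod_left, fun t => ?_⟩
    set e : EuclideanSpace ℝ (Fin n) → ℂ :=
      fun x => Complex.exp (Complex.I * ((inner ℝ x t : ℝ) : ℂ)) with he
    have hHe : Integrable (fun p : EuclideanSpace ℝ (Fin n) × Ω =>
        e p.1 * ((Real.exp (‖p.1‖ * -Y p.2) : ℝ) : ℂ)) (volume.prod m) := by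
      refine hH.ofReal.bdd_mul (c := 1) ?_ (ae_of_all _ fun p => ?_)
      · refine Measurable.aestronglyMeasurable ?_
        simp only [he]
        fun_prop
      · simp only [he]
        rw [mul_comm, Complex.norm_exp_ofReal_mul_I]
    have h1 := integral_integral_swap
      (f := fun x z => e x * ((Real.exp (‖x‖ * -Y z) : ℝ) : ℂ)) hHe
    have h2 : ∀ z, ∫ x, e x * ((Real.exp (‖x‖ * -Y z) : ℝ) : ℂ) =
        ((poissonConst n * Y z * (Y z ^ 2 + ‖t‖ ^ 2) ^ (-(((n : ℝ) + 1) / 2)) : ℝ) : ℂ) := by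
      intro z
      rw [← (fourier_exp_neg_norm hn (hY z)).2 t]
      simp only [mul_neg, he]
    simp_rw [h2, integral_const_mul, integral_complex_ofReal] at h1
    rw [hval _ (norm_nonneg t)] at h1
    exact h1
  exact ⟨⟨_, hq⟩, fun p hp => hcm.congr (hp.eqOn hn hq)⟩

/-! ### Raising the order of a Stieltjes representation. -/

theorem integrableOn_rpow_mul_add_rpow {a κ : ℝ} (ha : 0 < a) (haκ : a < κ) :
    IntegrableOn (fun w : ℝ => w ^ (a - 1) * (1 + w) ^ (-κ)) (Ioi 0) := by
  have hmeas : Measurable fun w : ℝ => w ^ (a - 1) * (1 + w) ^ (-κ) := by fun_prop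
  rw [← Ioc_union_Ioi_eq_Ioi zero_le_one, integrableOn_union]
  constructor
  · have h1 : IntegrableOn (fun w : ℝ => w ^ (a - 1)) (Ioc 0 1) :=
      (intervalIntegral.intervalIntegrable_rpow' (by linarith)).1
    refine Integrable.mono' h1 hmeas.aestronglyMeasurable
      ((ae_restrict_iff' measurableSet_Ioc).2 (ae_of_all _ fun w hw => ?_))
    have hw0 : 0 < w := hw.1
    rw [Real.norm_of_nonneg (by positivity)]
    exact mul_le_of_le_one_right (by positivity)
      (Real.rpow_le_one_of_one_le_of_nonpos (by linarith) (by linarith))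
  · have h1 : IntegrableOn (fun w : ℝ => w ^ (a - 1 - κ)) (Ioi 1) :=
      integrableOn_Ioi_rpow_of_lt (by linarith) one_pos
    refine Integrable.mono' h1 hmeas.aestronglyMeasurable
      ((ae_restrict_iff' measurableSet_Ioi).2 (ae_of_all _ fun w hw => ?_))
    have hw0 : 0 < w := one_pos.trans hw
    rw [Real.norm_of_nonneg (by positivity), sub_eq_add_neg (a - 1), Real.rpow_add hw0]
    exact mul_le_mul_of_nonneg_left
      (Real.rpow_le_rpow_of_nonpos hw0 (by linarith) (by linarith)) (by positivity)

/-- A power `c ^ (-b)` is a positive mixture of the powers `(c + w) ^ (-κ)` with `w ≥ 0`,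
when `0 < b ≤ κ`. -/
theorem exists_measure_lintegral_add_abs_rpow {b κ : ℝ} (hb : 0 < b) (hbκ : b ≤ κ) :
    ∃ γ : Measure ℝ, SFinite γ ∧ ∀ c : ℝ, 0 < c →
      ∫⁻ w, ENNReal.ofReal ((c + |w|) ^ (-κ)) ∂γ = ENNReal.ofReal (c ^ (-b)) := by
  rcases hbκ.eq_or_lt with rfl | hlt
  · refine ⟨Measure.dirac 0, inferInstance, fun c _ => ?_⟩
    rw [lintegral_dirac]
    simp
  set a : ℝ := κ - b with ha
  have ha0 : 0 < a := by linarith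
  set f : ℝ → ℝ := fun w => w ^ (a - 1) * (1 + w) ^ (-κ) with hf
  have hfi : IntegrableOn f (Ioi 0) := integrableOn_rpow_mul_add_rpow ha0 (by linarith)
  have hfpos : ∀ w ∈ Ioi (0 : ℝ), 0 < f w := fun w hw => by
    have : 0 < w := hw
    positivity
  set B : ℝ := ∫ w in Ioi 0, f w with hB
  have hB0 : 0 < B := by
    rw [hB, setIntegral_pos_iff_support_of_nonneg_ae
      ((ae_restrict_iff' measurableSet_Ioi).2 (ae_of_all _ fun w hw => (hfpos w hw).le)) hfi]
    have : Function.support f ∩ Ioi 0 = Ioi 0 :=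
      inter_eq_right.2 fun w hw => (hfpos w hw).ne'
    rw [this]
    simp
  have hscale : ∀ c : ℝ, 0 < c → ∀ w ∈ Ioi (0 : ℝ),
      w ^ (a - 1) * (c + w) ^ (-κ) = c ^ (-b - 1) * f (c⁻¹ * w) := by
    intro c hc w hw
    have hw0 : 0 < w := hw
    have h1 : c + w = c * (1 + c⁻¹ * w) := by field_simp
    rw [hf, h1, Real.mul_rpow hc.le (by positivity)]
    simp only
    rw [Real.mul_rpow (by positivity) hw0.le, Real.inv_rpow hc.le, ← Real.rpow_neg hc.le,
      show -κ = (-b - 1) + -(a - 1) by rw [ha]; ring, Real.rpow_add hc]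
    ring
  -- The scaling `w ↦ c w` gives `∫ w ^ (a - 1) * (c + w) ^ (-κ) = B * c ^ (-b)` with `a = κ - b`;
  -- dividing by the Beta integral `B` normalizes.
  refine ⟨(volume.restrict (Ioi 0)).withDensity fun w => ENNReal.ofReal (w ^ (a - 1) / B),
    inferInstance, fun c hc => ?_⟩
  rw [lintegral_withDensity_eq_lintegral_mul _ (by fun_prop) (by fun_prop)]
  have h1 : ∀ w ∈ Ioi (0 : ℝ), ((fun w => ENNReal.ofReal (w ^ (a - 1) / B)) *
      fun w => ENNReal.ofReal ((c + |w|) ^ (-κ))) w =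
      ENNReal.ofReal (c ^ (-b - 1) / B * f (c⁻¹ * w)) := by
    intro w hw
    have hw0 : 0 < w := hw
    rw [Pi.mul_apply, ← ENNReal.ofReal_mul (by positivity), abs_of_pos hw0, div_mul_eq_mul_div,
      hscale c hc w hw]
    congr 1
    ring
  rw [setLIntegral_congr_fun measurableSet_Ioi h1, ← ofReal_integral_eq_lintegral_ofReal,
    integral_const_mul, integral_comp_mul_left_Ioi f 0 (inv_pos.2 hc), mul_zero, ← hB,
    smul_eq_mul, inv_inv, Real.rpow_sub_one hc.ne']
  · congr 1
    field_simp
  · refine Integrable.const_mul ?_ _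
    have := (integrableOn_Ioi_comp_mul_left_iff f 0 (inv_pos.2 hc)).2 (by simpa using hfi)
    exact this
  · refine (ae_restrict_iff' measurableSet_Ioi).2 (ae_of_all _ fun w hw => ?_)
    have hw0 : 0 < w := hw
    have := (hfpos (c⁻¹ * w) (by simp only [mem_Ioi]; positivity)).le
    simp only [Pi.zero_apply]
    positivity

/-- Each power of order `b` is expanded into powers of order `(n+1)/2`. The mixing variable is `Y =
√(U + |w|)`, and the density `1 / (C * Y)` cancels the prefactor of the Poisson-type kernel. -/
theorem linnik_of_stieltjes {Ω : Type*} [MeasurableSpace Ω] {μ : Measure Ω} [SFinite μ]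
    {U : Ω → ℝ} (hUm : Measurable U) (hU : ∀ z, 0 < U z) {α ν b : ℝ} {n : ℕ} (hn : 1 ≤ n)
    (hb : 0 < b) (hbn : b ≤ ((n : ℝ) + 1) / 2)
    (hmix : ∀ a : ℝ, 0 ≤ a → ∫⁻ z, ENNReal.ofReal ((U z + a ^ 2) ^ (-b)) ∂μ =
        ENNReal.ofReal (1 / (1 + a ^ α) ^ ν)) :
    (∃ q : ℝ → ℝ, IsLinnikRadialDensity α ν n q) ∧
      ∀ q : ℝ → ℝ, IsLinnikRadialDensity α ν n q → CompletelyMonotonic q := by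
  obtain ⟨γ, _, hγ⟩ := exists_measure_lintegral_add_abs_rpow hb hbn
  have hC := poissonConst_pos n
  set Y : Ω × ℝ → ℝ := fun p => √(U p.1 + |p.2|) with hYdef
  have hYm : Measurable Y := by fun_prop
  have hYsq : ∀ p : Ω × ℝ, 0 < U p.1 + |p.2| := fun p => add_pos_of_pos_of_nonneg (hU _) (abs_nonneg _)
  have hY : ∀ p, 0 < Y p := fun p => Real.sqrt_pos.2 (hYsq p)
  refine linnik_of_mixture (m := (μ.prod γ).withDensity fun p =>
    ENNReal.ofReal (1 / (poissonConst n * Y p))) hYm hY hn fun a ha => ?_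
  rw [lintegral_withDensity_eq_lintegral_mul _ (by fun_prop) (by fun_prop), ← hmix a ha]
  have h1 : ∀ p : Ω × ℝ, ((fun p => ENNReal.ofReal (1 / (poissonConst n * Y p))) * fun p =>
      ENNReal.ofReal (poissonConst n * Y p * (Y p ^ 2 + a ^ 2) ^ (-(((n : ℝ) + 1) / 2)))) p =
      ENNReal.ofReal ((U p.1 + a ^ 2 + |p.2|) ^ (-(((n : ℝ) + 1) / 2))) := by
    intro p
    have := hY p
    rw [Pi.mul_apply, ← ENNReal.ofReal_mul (by positivity), ← mul_assoc,
      one_div_mul_cancel (by positivity), one_mul, hYdef]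
    simp only
    rw [Real.sq_sqrt (hYsq p).le, add_right_comm]
  rw [lintegral_congr h1, lintegral_prod _ (by fun_prop)]
  refine lintegral_congr fun z => ?_
  exact hγ _ (add_pos_of_pos_of_nonneg (hU z) (sq_nonneg a))

/-! ### The Stieltjes representation of `(1 + s ^ β) ^ (-ν)` by contour integration. -/

/-- The function `z ↦ (1 + z ^ β) ^ (-ν)` in the logarithmic variable `w = log z`. -/
noncomputable def linnikLog (β ν : ℝ) (w : ℂ) : ℂ :=
  (1 + Complex.exp ((β : ℂ) * w)) ^ (-(ν : ℂ))

/-- As `β < 1`, the angle `β * w.im` stays strictly inside `(-π, π)`, even on the edges of the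
strip, so the exponential never meets the negative axis. -/
theorem one_add_exp_mem_slitPlane {β : ℝ} (hβ0 : 0 < β) (hβ1 : β < 1) {w : ℂ}
    (hw : |w.im| ≤ Real.pi) : 1 + Complex.exp ((β : ℂ) * w) ∈ Complex.slitPlane := by
  rw [Complex.mem_slitPlane_iff]
  have him : ((β : ℂ) * w).im = β * w.im := by simp
  have hlt : |β * w.im| < Real.pi := by
    rw [abs_mul, abs_of_pos hβ0]
    nlinarith [Real.pi_pos, abs_nonneg w.im]
  rw [abs_lt] at hlt
  simp only [Complex.add_re, Complex.one_re, Complex.exp_re, Complex.add_im, Complex.one_im,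
    Complex.exp_im, zero_add, him]
  by_cases h0 : Real.sin (β * w.im) = 0
  · left
    rw [(Real.sin_eq_zero_iff_of_lt_of_lt hlt.1 hlt.2).1 h0, Real.cos_zero]
    positivity
  · right
    exact mul_ne_zero (Real.exp_pos _).ne' h0

theorem differentiableAt_linnikLog {β : ℝ} (hβ0 : 0 < β) (hβ1 : β < 1) (ν : ℝ) {w : ℂ}
    (hw : |w.im| ≤ Real.pi) : DifferentiableAt ℂ (linnikLog β ν) w :=
  DifferentiableAt.cpow (by fun_prop) (by fun_prop) (one_add_exp_mem_slitPlane hβ0 hβ1 hw)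

theorem linnikLog_ofReal (β ν c : ℝ) :
    linnikLog β ν c = (((1 + Real.exp (β * c)) ^ (-ν) : ℝ) : ℂ) := by
  rw [linnikLog, Complex.ofReal_cpow (by positivity)]
  push_cast
  rfl

theorem linnikLog_conj {β : ℝ} (hβ0 : 0 < β) (hβ1 : β < 1) (ν : ℝ) {w : ℂ}
    (hw : |w.im| ≤ Real.pi) :
    linnikLog β ν (starRingEnd ℂ w) = starRingEnd ℂ (linnikLog β ν w) := by
  have h := Complex.conj_cpow _ (-(ν : ℂ))
    (Complex.slitPlane_arg_ne_pi (one_add_exp_mem_slitPlane hβ0 hβ1 hw))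
  simpa [linnikLog, ← Complex.exp_conj] using h

/-- On the lower edge the base `z = 1 + exp (β w)` has argument in `[-βπ, 0)`, so its power `-ν` has
argument in `[0, βνπ]`, within `[0, π]`. -/
theorem linnikLog_im_nonneg {β ν : ℝ} (hβ0 : 0 < β) (hβ1 : β < 1) (hν : 0 < ν) (hβν : β * ν ≤ 1)
    (x : ℝ) : 0 ≤ (linnikLog β ν (x + (-Real.pi : ℝ) * Complex.I)).im := by
  have hpi := Real.pi_pos
  set w : ℂ := x + (-Real.pi : ℝ) * Complex.I with hw
  have hwre : w.re = x := by simp [hw]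
  have hwim : w.im = -Real.pi := by simp [hw]
  have hslit := one_add_exp_mem_slitPlane hβ0 hβ1 (w := w) (by rw [hwim, abs_neg, abs_of_pos hpi])
  set z : ℂ := 1 + Complex.exp ((β : ℂ) * w) with hz
  have hz0 : z ≠ 0 := Complex.slitPlane_ne_zero hslit
  have hzre : z.re = 1 + Real.exp (β * x) * Real.cos (β * Real.pi) := by
    simp [hz, Complex.exp_re, hwre, hwim]
  have hzim : z.im = -(Real.exp (β * x) * Real.sin (β * Real.pi)) := by
    simp [hz, Complex.exp_im, hwre, hwim]
  have hsin : 0 < Real.sin (β * Real.pi) :=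
    Real.sin_pos_of_pos_of_lt_pi (by positivity) (by nlinarith)
  have harg0 : z.arg < 0 := by
    rw [Complex.arg_neg_iff, hzim, neg_lt_zero]
    positivity
  have harg1 : -(β * Real.pi) ≤ z.arg := by
    by_contra! hcon
    have h1 : Real.sin (z.arg + β * Real.pi) < 0 :=
      Real.sin_neg_of_neg_of_neg_pi_lt (by linarith)
        (by nlinarith [Complex.neg_pi_lt_arg z])
    -- Both sides are the imaginary part of `z * exp (iβπ) = exp (iβπ) + exp (β x)`.
    have h2 : ‖z‖ * Real.sin (z.arg + β * Real.pi) = Real.sin (β * Real.pi) := by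
      rw [Real.sin_add, mul_add, ← mul_assoc, ← mul_assoc, Complex.norm_mul_sin_arg,
        Complex.norm_mul_cos_arg, hzre, hzim]
      ring
    nlinarith [norm_pos_iff.2 hz0]
  rw [linnikLog, ← hz, Complex.cpow_def_of_ne_zero hz0, Complex.exp_im]
  refine mul_nonneg (Real.exp_pos _).le ?_
  have him : (Complex.log z * -(ν : ℂ)).im = -(ν * z.arg) := by
    simp [Complex.log_im]; ring
  rw [him]
  exact Real.sin_nonneg_of_nonneg_of_le_pi (by nlinarith) (by nlinarith)

open Filter Topology in
-- A limit along `comap Complex.re` is uniform in the imaginary part, which gives the constant bound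
-- for dominated convergence.
theorem tendsto_intervalIntegral_vertical {h : ℂ → ℂ} (hm : Measurable h) {l : ℂ}
    {𝓕 : Filter ℝ} [𝓕.IsCountablyGenerated] (hl : Tendsto h (comap Complex.re 𝓕) (𝓝 l)) (a b : ℝ) :
    Tendsto (fun L : ℝ => ∫ y in a..b, h (L + y * Complex.I)) 𝓕 (𝓝 ((b - a : ℝ) • l)) := by
  rw [← intervalIntegral.integral_const]
  have hcomp : ∀ y : ℝ, Tendsto (fun L : ℝ => (L : ℂ) + y * Complex.I) 𝓕 (comap Complex.re 𝓕) := by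
    intro y
    rw [tendsto_comap_iff]
    convert tendsto_id using 1
    ext L
    simp
  have hbd : ∀ᶠ L in 𝓕, ∀ w : ℂ, w.re = L → ‖h w‖ ≤ ‖l‖ + 1 := by
    have h1 : ∀ᶠ w in comap Complex.re 𝓕, ‖h w‖ ≤ ‖l‖ + 1 :=
      hl.norm.eventually_le_const (lt_add_one _)
    rw [eventually_comap] at h1
    exact h1
  refine intervalIntegral.tendsto_integral_filter_of_dominated_convergence (fun _ => ‖l‖ + 1)
    (Eventually.of_forall fun L => (hm.comp (by fun_prop)).aestronglyMeasurable) ?_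
    intervalIntegrable_const (ae_of_all _ fun y _ => hl.comp (hcomp y))
  filter_upwards [hbd] with L hL
  exact ae_of_all _ fun y _ => hL _ (by simp)

open Filter Topology Bornology in
theorem tendsto_linnikLog_atTop {β ν : ℝ} (hβ : 0 < β) (hν : 0 < ν) :
    Tendsto (linnikLog β ν) (comap Complex.re atTop) (𝓝 0) := by
  have h1 : Tendsto (fun w : ℂ => (β : ℂ) * w) (comap Complex.re atTop) (comap Complex.re atTop) := by
    rw [tendsto_comap_iff]
    have : (Complex.re ∘ fun w : ℂ => (β : ℂ) * w) = fun w => β * w.re := by ext w; simp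
    rw [this]
    exact tendsto_comap.const_mul_atTop hβ
  have h2 : Tendsto (fun w : ℂ => ‖1 + Complex.exp ((β : ℂ) * w)‖) (comap Complex.re atTop) atTop := by
    have h3 := tendsto_norm_cobounded_atTop.comp (Complex.tendsto_exp_comap_re_atTop.comp h1)
    refine tendsto_atTop_mono (fun w => ?_) (tendsto_atTop_add_const_right _ (-1) h3)
    have := norm_sub_le (1 + Complex.exp ((β : ℂ) * w)) 1
    simp only [add_sub_cancel_left, norm_one] at this
    simp only [Function.comp_apply]
    linarith
  rw [tendsto_zero_iff_norm_tendsto_zero]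
  refine ((tendsto_rpow_neg_atTop hν).comp h2).congr fun w => ?_
  rw [linnikLog, Function.comp_apply, ← Complex.ofReal_neg, Complex.norm_cpow_real]

open Filter Topology in
theorem tendsto_linnikLog_atBot {β : ℝ} (hβ : 0 < β) (ν : ℝ) :
    Tendsto (linnikLog β ν) (comap Complex.re atBot) (𝓝 1) := by
  have h1 : Tendsto (fun w : ℂ => (β : ℂ) * w) (comap Complex.re atBot) (comap Complex.re atBot) := by
    rw [tendsto_comap_iff]
    have : (Complex.re ∘ fun w : ℂ => (β : ℂ) * w) = fun w => β * w.re := by ext w; simp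
    rw [this]
    exact tendsto_comap.const_mul_atBot hβ
  have h2 : Tendsto (fun w : ℂ => 1 + Complex.exp ((β : ℂ) * w)) (comap Complex.re atBot) (𝓝 1) := by
    simpa using (Complex.tendsto_exp_comap_re_atBot.comp h1).const_add 1
  have h3 : ContinuousAt (fun z : ℂ => z ^ (-(ν : ℂ))) 1 :=
    continuousAt_cpow_const Complex.one_mem_slitPlane
  have h4 := h3.tendsto.comp h2
  simp only [Complex.one_cpow] at h4
  exact h4

theorem measurable_linnikLog (β ν : ℝ) : Measurable (linnikLog β ν) := by
  unfold linnikLog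
  fun_prop

theorem exp_ne_exp_of_abs_im_le_pi {c : ℝ} {w : ℂ} (hw : |w.im| ≤ Real.pi) (hwc : w ≠ c) :
    Complex.exp w ≠ Complex.exp c := by
  intro h
  obtain ⟨k, hk⟩ := Complex.exp_eq_exp_iff_exists_int.1 h
  have him : w.im = k * (2 * Real.pi) := by rw [hk]; simp
  have hpi := Real.pi_pos
  have hk0 : k = 0 := by
    rw [him, abs_mul, abs_of_pos (by positivity : (0 : ℝ) < 2 * Real.pi)] at hw
    have h1 : |(k : ℝ)| < 1 := by nlinarith
    have h2 : |k| < 1 := by exact_mod_cast h1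
    exact Int.abs_lt_one_iff.1 h2
  apply hwc
  rw [hk, hk0]
  simp

open Topology in
/-- Cauchy's theorem on the rectangle `[-L, L] × [-π, π]` for the integrand with the simple pole at
`c` removed. -/
theorem linnikLog_rect_integral {β ν : ℝ} (hβ0 : 0 < β) (hβ1 : β < 1) {c L : ℝ} (hcL : |c| < L) :
    let h : ℂ → ℂ := fun w => (linnikLog β ν w - linnikLog β ν c) *
      (Complex.exp w / (Complex.exp w - Complex.exp c))
    (∫ x : ℝ in (-L)..L, ((2 * (linnikLog β ν (x + (-Real.pi : ℝ) * Complex.I)).im *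
        (Real.exp x / (Real.exp x + Real.exp c)) : ℝ) : ℂ) * Complex.I) +
      Complex.I • (∫ y : ℝ in (-Real.pi)..Real.pi, h (L + y * Complex.I)) -
      Complex.I • (∫ y : ℝ in (-Real.pi)..Real.pi, h ((-L : ℝ) + y * Complex.I)) = 0 := by
  intro h
  have hpi := Real.pi_pos
  have hL : 0 < L := (abs_nonneg c).trans_lt hcL
  obtain ⟨hc1, hc2⟩ := abs_lt.1 hcL
  -- A quotient of divided differences: it equals `h` off `c` and fills in the removable singularity
  -- there.
  set g : ℂ → ℂ := fun w => dslope (linnikLog β ν) c w * (Complex.exp w / dslope Complex.exp c w)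
    with hg
  have hgh : ∀ w : ℂ, w ≠ c → g w = h w := by
    intro w hw
    have hw' : w - c ≠ 0 := sub_ne_zero.2 hw
    simp only [hg, h]
    rw [dslope_of_ne _ hw, dslope_of_ne _ hw, slope_def_module, slope_def_module, smul_eq_mul,
      smul_eq_mul, div_eq_mul_inv, mul_inv, inv_inv]
    field_simp
  set z : ℂ := (-L : ℝ) + (-Real.pi : ℝ) * Complex.I with hz
  set w : ℂ := (L : ℝ) + (Real.pi : ℝ) * Complex.I with hw
  have hzre : z.re = -L := by simp [hz]
  have hzim : z.im = -Real.pi := by simp [hz]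
  have hwre : w.re = L := by simp [hw]
  have hwim : w.im = Real.pi := by simp [hw]
  have hstrip : ∀ u ∈ uIcc z.re w.re ×ℂ uIcc z.im w.im, |u.im| ≤ Real.pi := by
    intro u hu
    have := hu.2
    rw [mem_preimage, hzim, hwim, uIcc_of_le (by linarith)] at this
    exact abs_le.2 this
  have hnhds : uIcc z.re w.re ×ℂ uIcc z.im w.im ∈ 𝓝 (c : ℂ) := by
    rw [hzre, hzim, hwre, hwim, uIcc_of_le (by linarith), uIcc_of_le (by linarith)]
    refine Filter.mem_of_superset (IsOpen.mem_nhds (isOpen_Ioo.reProdIm isOpen_Ioo) (?_ :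
      (c : ℂ) ∈ Ioo (-L) L ×ℂ Ioo (-Real.pi) Real.pi)) ?_
    · exact ⟨by simpa using ⟨hc1, hc2⟩, by simpa using hpi⟩
    · exact inter_subset_inter (preimage_mono Ioo_subset_Icc_self)
        (preimage_mono Ioo_subset_Icc_self)
  have hd : DifferentiableOn ℂ g (uIcc z.re w.re ×ℂ uIcc z.im w.im) := by
    refine DifferentiableOn.mul ((Complex.differentiableOn_dslope hnhds).2 fun u hu =>
      (differentiableAt_linnikLog hβ0 hβ1 ν (hstrip u hu)).differentiableWithinAt)
      (Complex.differentiable_exp.differentiableOn.div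
        ((Complex.differentiableOn_dslope hnhds).2 Complex.differentiable_exp.differentiableOn) ?_)
    intro u hu
    by_cases huc : u = c
    · rw [huc, dslope_same, Complex.deriv_exp]
      exact Complex.exp_ne_zero _
    · rw [dslope_of_ne _ huc, slope_def_module]
      exact smul_ne_zero (inv_ne_zero (sub_ne_zero.2 huc))
        (sub_ne_zero.2 (exp_ne_exp_of_abs_im_le_pi (hstrip u hu) huc))
  have hrect := Complex.integral_boundary_rect_eq_zero_of_differentiableOn g z w hd
  rw [hzre, hzim, hwre, hwim] at hrect
  have hright : ∀ y : ℝ, g (L + y * Complex.I) = h (L + y * Complex.I) := fun y => hgh _ (by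
    intro hcon
    have := congrArg Complex.re hcon
    simp at this
    linarith)
  have hleft : ∀ y : ℝ, g ((-L : ℝ) + y * Complex.I) = h ((-L : ℝ) + y * Complex.I) :=
    fun y => hgh _ (by
      intro hcon
      have := congrArg Complex.re hcon
      simp at this
      linarith)
  have hbot : ∀ x : ℝ, g (x + (-Real.pi : ℝ) * Complex.I) = h (x + (-Real.pi : ℝ) * Complex.I) :=
    fun x => hgh _ (by
      intro hcon
      have := congrArg Complex.im hcon
      simp at this)
  have htop : ∀ x : ℝ, g (x + Real.pi * Complex.I) = h (x + Real.pi * Complex.I) :=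
    fun x => hgh _ (by
      intro hcon
      have := congrArg Complex.im hcon
      simp at this)
  have hib : IntervalIntegrable (fun x : ℝ => g (x + (-Real.pi : ℝ) * Complex.I)) volume (-L) L := by
    refine ContinuousOn.intervalIntegrable (hd.continuousOn.comp (by fun_prop) fun x hx => ?_)
    refine ⟨by simpa [hzre, hwre] using hx, ?_⟩
    rw [mem_preimage, hzim]
    simp
  have hit : IntervalIntegrable (fun x : ℝ => g (x + Real.pi * Complex.I)) volume (-L) L := by
    refine ContinuousOn.intervalIntegrable (hd.continuousOn.comp (by fun_prop) fun x hx => ?_)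
    refine ⟨by simpa [hzre, hwre] using hx, ?_⟩
    rw [mem_preimage, hwim]
    simp
  -- On both horizontal edges `exp` equals `-exp x`, while the values of `linnikLog` are conjugate;
  -- the difference retains only twice the imaginary part.
  have hdiff : ∀ x : ℝ, g (x + (-Real.pi : ℝ) * Complex.I) - g (x + Real.pi * Complex.I) =
      ((2 * (linnikLog β ν (x + (-Real.pi : ℝ) * Complex.I)).im *
        (Real.exp x / (Real.exp x + Real.exp c)) : ℝ) : ℂ) * Complex.I := by
    intro x
    have e1 : Complex.exp ((x : ℂ) + (-Real.pi : ℝ) * Complex.I) = -Complex.exp x := by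
      rw [Complex.exp_add, Complex.ofReal_neg, neg_mul, Complex.exp_neg, Complex.exp_pi_mul_I]
      simp
    have e2 : Complex.exp ((x : ℂ) + Real.pi * Complex.I) = -Complex.exp x := by
      rw [Complex.exp_add, Complex.exp_pi_mul_I, mul_neg_one]
    have e3 : linnikLog β ν (x + Real.pi * Complex.I) =
        starRingEnd ℂ (linnikLog β ν (x + (-Real.pi : ℝ) * Complex.I)) := by
      rw [← linnikLog_conj hβ0 hβ1 ν (by simp [abs_of_pos hpi])]
      simp
    have e4 := Complex.sub_conj (linnikLog β ν (x + (-Real.pi : ℝ) * Complex.I))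
    rw [hbot, htop]
    simp only [h]
    rw [e1, e2, e3, ← sub_mul, sub_sub_sub_cancel_right, e4, ← neg_add', neg_div_neg_eq]
    push_cast
    ring
  simp_rw [hright, hleft] at hrect
  rw [← intervalIntegral.integral_sub hib hit] at hrect
  simp_rw [hdiff] at hrect
  exact hrect

open Filter Topology in
-- As `L → ∞` the integrand `h` tends to `0` on the left edge and to `-linnikLog β ν c` on the right
-- one, so the right edge, of length `2π`, yields the limit.
theorem tendsto_integral_linnikLog_im {β ν : ℝ} (hβ0 : 0 < β) (hβ1 : β < 1) (hν : 0 < ν) (c : ℝ) :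
    Tendsto (fun L : ℝ => ∫ x in (-L)..L, (linnikLog β ν (x + (-Real.pi : ℝ) * Complex.I)).im *
      (Real.exp x / (Real.exp x + Real.exp c))) atTop
      (𝓝 (Real.pi * (1 + Real.exp (β * c)) ^ (-ν))) := by
  set h : ℂ → ℂ := fun w => (linnikLog β ν w - linnikLog β ν c) *
    (Complex.exp w / (Complex.exp w - Complex.exp c)) with hh
  have hm : Measurable h := by
    have := measurable_linnikLog β ν
    fun_prop
  have hr : Tendsto h (comap Complex.re atTop) (𝓝 (-linnikLog β ν c)) := by
    have h1 : Tendsto (fun w : ℂ => (1 - Complex.exp c * (Complex.exp w)⁻¹)⁻¹)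
        (comap Complex.re atTop) (𝓝 1) := by
      have h2 := ((tendsto_inv₀_cobounded.comp Complex.tendsto_exp_comap_re_atTop).const_mul
        (Complex.exp c)).const_sub 1
      simpa using h2.inv₀ (by simp)
    have h2 := ((tendsto_linnikLog_atTop hβ0 hν).sub_const (linnikLog β ν c)).mul h1
    rw [zero_sub, mul_one] at h2
    refine h2.congr fun w => ?_
    simp only [hh]
    congr 1
    have := Complex.exp_ne_zero w
    rw [← div_eq_mul_inv, one_sub_div this, inv_div]
  have hl : Tendsto h (comap Complex.re atBot) (𝓝 0) := by
    have h1 := Complex.tendsto_exp_comap_re_atBot.div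
      (Complex.tendsto_exp_comap_re_atBot.sub_const (Complex.exp c))
      (by simp)
    simpa using ((tendsto_linnikLog_atBot hβ0 ν).sub_const (linnikLog β ν c)).mul h1
  have hvr := tendsto_intervalIntegral_vertical hm hr (-Real.pi) Real.pi
  have hvl := (tendsto_intervalIntegral_vertical hm hl (-Real.pi) Real.pi).comp
    tendsto_neg_atTop_atBot
  have hlim := ((hvl.const_smul Complex.I).sub (hvr.const_smul Complex.I)).congr' (f₂ := fun L =>
    (((∫ x in (-L)..L, 2 * (linnikLog β ν (x + (-Real.pi : ℝ) * Complex.I)).im *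
      (Real.exp x / (Real.exp x + Real.exp c)) : ℝ) : ℂ) * Complex.I)) (by
    filter_upwards [eventually_gt_atTop |c|] with L hL
    have h1 := linnikLog_rect_integral (ν := ν) hβ0 hβ1 hL
    simp only at h1
    rw [intervalIntegral.integral_mul_const, intervalIntegral.integral_ofReal] at h1
    simp only [Function.comp_apply]
    linear_combination -h1)
  have him := (Complex.continuous_im.tendsto _).comp hlim
  have h2 := him.const_mul (1 / 2)
  rw [linnikLog_ofReal] at h2
  convert! h2 using 1
  · ext L
    simp only [Function.comp_apply, Complex.mul_im, Complex.ofReal_re, Complex.ofReal_im,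
      Complex.I_re, Complex.I_im, mul_one, mul_zero, add_zero]
    rw [← intervalIntegral.integral_const_mul]
    congr 1
    ext x
    ring
  · congr 1
    simp
    ring

open Filter Topology in
-- For a nonnegative integrand, convergence of the symmetric integrals already forces integrability.
theorem lintegral_of_tendsto_intervalIntegral {f : ℝ → ℝ} (hf : ∀ x, 0 ≤ f x)
    (hi : ∀ L : ℝ, IntervalIntegrable f volume (-L) L) {l : ℝ}
    (h : Tendsto (fun L : ℝ => ∫ x in (-L)..L, f x) atTop (𝓝 l)) :
    ∫⁻ x, ENNReal.ofReal (f x) = ENNReal.ofReal l := by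
  have hint : Integrable f := by
    refine integrable_of_intervalIntegral_norm_tendsto (a := fun L : ℝ => -L) (b := fun L : ℝ => L)
      (l := atTop) l (fun L => (hi L).1) tendsto_neg_atTop_atBot tendsto_id ?_
    simpa only [Real.norm_of_nonneg (hf _)] using h
  rw [← ofReal_integral_eq_lintegral_ofReal hint (ae_of_all _ hf),
    tendsto_nhds_unique h
      (intervalIntegral_tendsto_integral hint tendsto_neg_atTop_atBot tendsto_id)]

open Filter Topology in
/-- The Stieltjes representation of `s ↦ (1 + s ^ β) ^ (-ν)`. -/
theorem exists_measure_lintegral_exp_add_inv {β ν : ℝ} (hβ0 : 0 < β) (hβ1 : β < 1) (hν : 0 < ν)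
    (hβν : β * ν ≤ 1) :
    ∃ μ : Measure ℝ, SFinite μ ∧ ∀ s : ℝ, 0 ≤ s →
      ∫⁻ x, ENNReal.ofReal ((Real.exp x + s) ^ (-1 : ℝ)) ∂μ =
        ENNReal.ofReal (1 / (1 + s ^ β) ^ ν) := by
  have hpi := Real.pi_pos
  set ρ : ℝ → ℝ := fun x => (linnikLog β ν (x + (-Real.pi : ℝ) * Complex.I)).im with hρ
  have hρ0 : ∀ x, 0 ≤ ρ x := linnikLog_im_nonneg hβ0 hβ1 hν hβν
  have hρc : Continuous ρ := by
    refine Complex.continuous_im.comp (continuous_iff_continuousAt.2 fun x => ?_)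
    exact ContinuousAt.comp (f := fun x : ℝ => (x : ℂ) + (-Real.pi : ℝ) * Complex.I)
      (differentiableAt_linnikLog hβ0 hβ1 ν (by simp [abs_of_pos hpi])).continuousAt (by fun_prop)
  have hρm : Measurable ρ := hρc.measurable
  have hpos : ∀ s : ℝ, 0 < s →
      ∫⁻ x, ENNReal.ofReal ((Real.exp x + s) ^ (-1 : ℝ))
        ∂(volume.withDensity fun x => ENNReal.ofReal (ρ x * Real.exp x / Real.pi)) =
        ENNReal.ofReal (1 / (1 + s ^ β) ^ ν) := by
    intro s hs
    have hcs : Real.exp (Real.log s) = s := Real.exp_log hs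
    have hsβ : Real.exp (β * Real.log s) = s ^ β := by
      rw [Real.rpow_def_of_pos hs, mul_comm]
    have h1 := (tendsto_integral_linnikLog_im hβ0 hβ1 hν (Real.log s)).const_mul (1 / Real.pi)
    simp_rw [hcs, ← intervalIntegral.integral_const_mul] at h1
    rw [hsβ, ← mul_assoc, one_div_mul_cancel hpi.ne', one_mul, Real.rpow_neg (by positivity),
      ← one_div] at h1
    rw [← lintegral_of_tendsto_intervalIntegral (fun x => ?_) (fun L => ?_) h1,
      lintegral_withDensity_eq_lintegral_mul _ (by fun_prop) (by fun_prop)]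
    · refine lintegral_congr fun x => ?_
      have := hρ0 x
      rw [Pi.mul_apply, ← ENNReal.ofReal_mul (by positivity), Real.rpow_neg_one]
      congr 1
      simp only [hρ]
      ring
    · have := hρ0 x
      positivity
    · refine Continuous.intervalIntegrable (continuous_const.mul (hρc.mul
        (Real.continuous_exp.div (by fun_prop) fun x => ?_))) _ _
      positivity
  refine ⟨volume.withDensity fun x => ENNReal.ofReal (ρ x * Real.exp x / Real.pi),
    inferInstance, fun s hs => ?_⟩
  rcases hs.eq_or_lt with rfl | hs
  swap
  · exact hpos s hs
  -- The contour argument used `log s`, so `s = 0` is reached by monotone convergence along `s = 1 /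
  -- (k + 1)`.
  have hseq : Tendsto (fun k : ℕ => 1 / ((k : ℝ) + 1)) atTop (𝓝 0) :=
    tendsto_one_div_add_atTop_nhds_zero_nat
  refine tendsto_nhds_unique (lintegral_tendsto_of_tendsto_of_monotone
    (f := fun (k : ℕ) x => ENNReal.ofReal ((Real.exp x + 1 / ((k : ℝ) + 1)) ^ (-1 : ℝ)))
    (fun k => by fun_prop) (ae_of_all _ fun x => ?_) (ae_of_all _ fun x => ?_)) ?_
  · intro k j hkj
    refine ENNReal.ofReal_le_ofReal (Real.rpow_le_rpow_of_nonpos (by positivity) ?_ (by norm_num))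
    exact add_le_add_right (Nat.one_div_le_one_div hkj) _
  · refine ENNReal.tendsto_ofReal ?_
    exact (hseq.const_add (Real.exp x)).rpow_const (Or.inl (by positivity))
  · simp_rw [hpos _ Nat.one_div_pos_of_nat]
    refine ENNReal.tendsto_ofReal ?_
    have h1 : Tendsto (fun k : ℕ => 1 + (1 / ((k : ℝ) + 1)) ^ β) atTop (𝓝 (1 + 0 ^ β)) :=
      (hseq.rpow_const (Or.inr hβ0.le)).const_add 1
    have h2 : (0 : ℝ) < 1 + 0 ^ β := by positivity
    exact tendsto_const_nhds.div (h1.rpow_const (Or.inl h2.ne')) (by positivity)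

/-! ### The two parameter ranges. -/

theorem mainTheorem10 (α ν : ℝ) (n : ℕ) (hn : 1 ≤ n)
    (h : (α ∈ Ioo (0 : ℝ) 2 ∧ α * ν ∈ Ioc (0 : ℝ) 2) ∨
      (α = 2 ∧ ν ∈ Ioc (0 : ℝ) (((n : ℝ) + 1) / 2))) :
    (∃ q : ℝ → ℝ, IsLinnikRadialDensity α ν n q) ∧
      ∀ q : ℝ → ℝ, IsLinnikRadialDensity α ν n q → CompletelyMonotonic q := by
  rcases h with ⟨⟨hα0, hα2⟩, hαν0, hαν2⟩ | ⟨rfl, hν0, hνn⟩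
  · have hν : 0 < ν := pos_of_mul_pos_right hαν0 hα0.le
    obtain ⟨μ, _, hμ⟩ := exists_measure_lintegral_exp_add_inv (β := α / 2) (ν := ν)
      (by linarith) (by linarith) hν (by linarith)
    have hn1 : (1 : ℝ) ≤ n := by exact_mod_cast hn
    -- Order `b = 1` is admissible because `1 ≤ (n + 1) / 2`; the Stieltjes variable is `s = a²`.
    refine linnik_of_stieltjes (μ := μ) Real.measurable_exp Real.exp_pos hn one_pos (by linarith)
      fun a ha => ?_
    rw [hμ _ (sq_nonneg a), ← Real.rpow_two, ← Real.rpow_mul ha, mul_div_cancel₀ _ two_ne_zero]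
  · refine linnik_of_stieltjes (μ := Measure.dirac ()) (U := fun _ => 1) measurable_const
      (fun _ => one_pos) hn hν0 hνn fun a ha => ?_
    rw [lintegral_dirac, Real.rpow_neg (by positivity), one_div, Real.rpow_two]
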